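/- Let $G$ be a finite connected simple graph, $A$ its set of arcs (each edge in both directions); $t(e)$ and $\bar e$ denote the terminus and the inverse of an arc $e$. **Embeddings.** An embedding of $G$ is given by a rotation system $(\rho,\tau)$: $\rho$ is a permutation of $A$ which restricts to one cyclic permutation of $\{e: t(e)=x\}$ for each vertex $x$, and $\tau:A\to\mathbb Z_2$ satisfies $\tau(\bar e)=\tau(e)$. Let $A^\tau=A\times\mathbb Z_2$, where $(e,k)$ is the lift of $e$ ending on the sheet $k$, with reversal $\overline{(e,k)}=(\bar e,k+\tau(e))$ and rotation $\tilde\rho(e,0)=(\rho(e),0)$, $\tilde\rho(e,1)=(\rho^{-1}(e),1)$. The facial walks are the cycles of $u\mapsto\overline{\tilde\rho(u)}$. A face is a facial walk up to inversion, where the inverse of the walk through $(e,k)$ is the walk through $(\bar e,k+\tau(e)+1)$; its length $|f|$ is the length of the cycle. A triangulation is an embedding all of whose faces have length $3$. A facial walk has a self-intersection if it passes through some arc $e$ of $G$ and also through $\bar e$. **Quantum walk.** Let $C=\begin{bmatrix}a&b\\c&d\end{bmatrix}$ be unitary with $0<a<1$, $d\in\mathbb R$ and $-\det C=1$. The arcs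 of the walk are, for each $u\in A^\tau$: island arcs $\xi_u^-$, from $u$ to a new vertex $x_u$, and $\xi_u^+$, from $x_u$ to $\tilde\rho(u)$; a bridge $\beta_u$ from $u$ to $\bar u$; and a tail at $x_u$ with incoming arcs $s_{u,0},s_{u,1},\dots$ and outgoing arcs $\bar s_{u,0},\bar s_{u,1},\dots$. With $u=(e,k)$, the evolution is $$\Psi_{n+1}(\xi_u^-)=a\Psi_n(\xi^+_{\tilde\rho^{-1}(u)})+b\Psi_n(\beta_{\bar u}),\qquad \Psi_{n+1}(\xi_u^+)=a\Psi_n(\xi_u^-)+b\Psi_n(s_{u,0}),$$ $$\Psi_{n+1}(\beta_u)=(-1)^{\tau(e)}\{c\Psi_n(\xi^+_{\tilde\rho^{-1}(u)})+d\Psi_n(\beta_{\bar u})\},\qquad \Psi_{n+1}(\bar s_{u,0})=c\Psi_n(\xi_u^-)+d\Psi_n(s_{u,0}),$$ $$\Psi_{n+1}(s_{u,j})=\Psi_n(s_{u,j+1}),\qquad \Psi_{n+1}(\bar s_{u,j+1})=\Psi_n(\bar s_{u,j}).$$ For an inflow $\alpha\in\mathbb C^{A^\tau}$, $\Psi_0(s_{u,j})=\alpha(u)$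 for all $j$ and $\Psi_0=0$ on all other arcs. Write $\Psi_\infty$ for the limit of $\Psi_n$ on each arc. The comfortability is $\mathcal E=\frac12\sum|\Psi_\infty(\cdot)|^2$ over all island arcs and bridges, its island part $\mathcal E^{island}$ is the part of this sum over the island arcs, and $\mathbb E$ is the average over the inflows $\alpha=\delta_u$, $u\in A^\tau$, chosen uniformly (read as $0$ if $A=\emptyset$). An embedding is the *best* one as $a\to1$ if for every embedding $\lim_{\delta\downarrow0}\delta^2\,\mathbb E[\mathcal E]$ with $a=1-\delta$ exists, independently of the choice of coins with this $a$, and this limit is maximal among all embeddings of $G$ for the given one. **Corollary.** Suppose that some embedding of $G$ is a triangulation. Then: 1. for every embedding of $G$, every coin $C$ as above and every inflow, the limit $\Psi_\infty$ exists on every arc; 2. the triangulation is a best embedding of $G$ as $a\to1$; 3. for every coin $C$ as above, the triangulation maximizes $\mathbb E[\mathcal E^{island}]$ among all embeddings of $G$; 4. the face lengths of the triangulation form an integer partition of $|A|$, and for every $0<a<1$ this partition maximizes the island energy $Q(\lambda)=\sum_{i}\lambda_i\frac{1+a^{\lambda_i}}{1-a^{\lambda_i}}$ among all integer partitions $\lambda=(\lambda_1,\dots,\lambda_r)$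 of $|A|$ with all parts at least $3$; 5. the triangulation has no self-intersections. -/

import Mathlib

open Filter Topology

namespace EmbeddedWalk

/-- A rotation system on a simple graph `G`. A dart `e` is an arc with origin `e.fst` and terminus
`e.snd`, and `e.symm` is the inverse arc. `rot` restricts to one cyclic permutation of the arcs
with terminus `x`, for every vertex `x`, and `twist` is the type of the edge. Rotation systems
are the combinatorial form of the two-cell embeddings of `G` into closed surfaces. -/
structure RotationSystem {V : Type*} (G : SimpleGraph V) where
  rot : Equiv.Perm G.Dart
  rot_snd : ∀ e : G.Dart, (rot e).snd = e.snd
  rot_cyclic : ∀ e e' : G.Dart, e.snd = e'.snd → rot.SameCycle e e'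
  twist : G.Dart → ZMod 2
  twist_symm : ∀ e : G.Dart, twist e.symm = twist e

/-- Arcs of the double cover with vertex set `V × ZMod 2`: the pair `(e, k)` is the lift of the arc
`e` with terminus `(e.snd, k)`, its origin being `(e.fst, k + twist e)`. -/
abbrev CoverArc {V : Type*} (G : SimpleGraph V) : Type _ := G.Dart × ZMod 2

/-- Arcs of the blow-up of the double cover, with one tail inserted into every island arc (the
hedgehog assignment). The vertices of the blow-up are the arcs `u` of the double cover; each of
them is the start of one island arc, leading to the next arc `ρ u` in the rotation, and of one
bridge, leading to the reversed arc. The island arc from `u` is cut by a new vertex `x_u`, the root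
of a tail.
* `quayIn u` goes from `u` to `x_u`, and `quayOut u` from `x_u` to `ρ u`;
* `bridge u` goes from `u` to the reversed arc of `u`;
* `tailIn u j` is the arc of the tail at `x_u` that points towards `x_u` and ends at distance `j`
  from it;
* `tailOut u j` is the arc inverse to `tailIn u j`. -/
inductive WalkArc (X : Type*) where
  | quayIn (u : X)
  | quayOut (u : X)
  | bridge (u : X)
  | tailIn (u : X) (j : ℕ)
  | tailOut (u : X) (j : ℕ)

/-- The coin: a unitary matrix `!![a, b; c, d]` with the given real `a`, with `d` real, and with
`ω = -det = 1`. -/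
structure IsCoin (C : Matrix (Fin 2) (Fin 2) ℂ) (a : ℝ) : Prop where
  unitary : C ∈ Matrix.unitaryGroup (Fin 2) ℂ
  a_eq : C 0 0 = (a : ℂ)
  d_real : (C 1 1).im = 0
  omega_eq : -C.det = 1

/-- `h(x) = x (1 + a ^ x) / (1 - a ^ x)`. -/
noncomputable def islandWeight (a : ℝ) (x : ℕ) : ℝ := x * ((1 + a ^ x) / (1 - a ^ x))

/-- The energy `Q` of all the islands for a multiset of face lengths. -/
noncomputable def islandEnergy (a : ℝ) (s : Multiset ℕ) : ℝ := (s.map (islandWeight a)).sum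

namespace RotationSystem

variable {V : Type*} {G : SimpleGraph V} (R : RotationSystem G)

/-- The rotation of the double cover: `rot` on the sheet `0` and its inverse on the sheet `1`. -/
def coverRot : Equiv.Perm (CoverArc G) where
  toFun v := (if v.2 = 0 then R.rot v.1 else R.rot.symm v.1, v.2)
  invFun v := (if v.2 = 0 then R.rot.symm v.1 else R.rot v.1, v.2)
  left_inv v := by
    rcases v with ⟨e, k⟩
    by_cases h : k = 0 <;> simp [h]
  right_inv v := by
    rcases v with ⟨e, k⟩
    by_cases h : k = 0 <;> simp [h]

/-- Reversal of the arcs of the double cover. -/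
def coverRev : Equiv.Perm (CoverArc G) where
  toFun v := (v.1.symm, v.2 + R.twist v.1)
  invFun v := (v.1.symm, v.2 + R.twist v.1)
  left_inv v := by simp [R.twist_symm, add_assoc, CharTwo.add_self_eq_zero]
  right_inv v := by simp [R.twist_symm, add_assoc, CharTwo.add_self_eq_zero]

/-- One step of a facial walk: `e` on the sheet `0` is followed by `(rot e).symm`, and on the sheet
`1` by `(rot⁻¹ e).symm`; the sheet is the sum of the twists traversed so far. The directed facial
walks are the cycles of this permutation. -/
def faceStep : Equiv.Perm (CoverArc G) := R.coverRot.trans R.coverRev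

/-- Reversal of an arc followed by the change of sheet. It sends a facial walk to its chiral copy,
which is the same facial walk of `G` traversed in the inverse direction. -/
def chiral : Equiv.Perm (CoverArc G) where
  toFun v := (v.1.symm, v.2 + R.twist v.1 + 1)
  invFun v := (v.1.symm, v.2 + R.twist v.1 + 1)
  left_inv v := by
    have h : ∀ x y : ZMod 2, x + y + 1 + y + 1 = x := by decide
    simp [R.twist_symm, h]
  right_inv v := by
    have h : ∀ x y : ZMod 2, x + y + 1 + y + 1 = x := by decide
    simp [R.twist_symm, h]

lemma chiral_chiral (v : CoverArc G) : R.chiral (R.chiral v) = v := R.chiral.left_inv v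

lemma faceStep_chiral (v : CoverArc G) :
    R.faceStep (R.chiral (R.faceStep v)) = R.chiral v := by
  have h1 : ∀ x y : ZMod 2, x + y + y + 1 = x + 1 := by decide
  have h2 : ∀ x y : ZMod 2, x ≠ 0 → y = x + y + 1 := by decide
  have h3 : ∀ x : ZMod 2, x ≠ 0 → x + 1 = 0 := by decide
  rcases v with ⟨e, k⟩
  by_cases h : k = 0
  · simp [faceStep, chiral, coverRot, coverRev, h, R.twist_symm, CharTwo.add_self_eq_zero, add_comm]
  · simp [faceStep, chiral, coverRot, coverRev, h, R.twist_symm, h1, h3 k h]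
    exact h2 k _ h

lemma chiral_conj : R.chiral * R.faceStep * R.chiral⁻¹ = R.faceStep⁻¹ := by
  have h3 : R.chiral⁻¹ = R.chiral := by
    ext1 u
    rw [Equiv.Perm.inv_eq_iff_eq]
    exact (R.chiral_chiral u).symm
  rw [eq_inv_iff_mul_eq_one, h3]
  ext1 v
  obtain ⟨w, rfl⟩ : ∃ w, v = R.faceStep w := ⟨R.faceStep.symm v, by simp⟩
  have h4 := R.faceStep_chiral (R.faceStep w)
  apply R.chiral.injective
  apply R.faceStep.injective
  simp only [Equiv.Perm.mul_apply, Equiv.Perm.one_apply, R.chiral_chiral]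
  rw [h4]

lemma sameCycle_chiral {v w : CoverArc G} :
    R.faceStep.SameCycle (R.chiral v) (R.chiral w) ↔ R.faceStep.SameCycle v w := by
  have h := Equiv.Perm.sameCycle_conj (f := R.faceStep) (g := R.chiral)
    (x := R.chiral v) (y := R.chiral w)
  rw [R.chiral_conj, Equiv.Perm.sameCycle_inv] at h
  simpa using h

/-- Two arcs of the double cover determine the same face when their facial walks agree up to cyclic
permutation and inversion. -/
def faceSetoid : Setoid (CoverArc G) where
  r v w := R.faceStep.SameCycle v w ∨ R.faceStep.SameCycle (R.chiral v) w
  iseqv :=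
    { refl := fun _ => Or.inl (Equiv.Perm.SameCycle.refl _ _)
      symm := by
        intro v w h
        rcases h with h | h
        · exact Or.inl h.symm
        · right
          have := R.sameCycle_chiral.2 h.symm
          rwa [R.chiral_chiral] at this
      trans := by
        intro u v w h h'
        rcases h with h | h <;> rcases h' with h' | h'
        · exact Or.inl (h.trans h')
        · exact Or.inr ((R.sameCycle_chiral.2 h).trans h')
        · exact Or.inr (h.trans h')
        · left
          have := R.sameCycle_chiral.2 h
          rw [R.chiral_chiral] at this
          exact this.trans h' }

/-- The set of faces. -/
def Face : Type _ := Quotient R.faceSetoid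

/-- The length of the facial walk through `v`. -/
noncomputable def walkLength (v : CoverArc G) : ℕ := Function.minimalPeriod R.faceStep v

lemma isPeriodicPt_iff (n : ℕ) (v : CoverArc G) :
    Function.IsPeriodicPt R.faceStep n v ↔ (R.faceStep ^ n) v = v := by
  rw [Function.IsPeriodicPt, Function.IsFixedPt, Equiv.Perm.iterate_eq_pow]

lemma walkLength_of_sameCycle {v w : CoverArc G} (h : R.faceStep.SameCycle v w) :
    R.walkLength v = R.walkLength w := by
  obtain ⟨i, rfl⟩ := h
  refine Function.minimalPeriod_eq_minimalPeriod_iff.2 fun n => ?_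
  rw [R.isPeriodicPt_iff, R.isPeriodicPt_iff, ← Equiv.Perm.mul_apply,
    (((Commute.refl R.faceStep).pow_left n).zpow_right i).eq, Equiv.Perm.mul_apply]
  exact (Equiv.injective _).eq_iff.symm

lemma walkLength_chiral (v : CoverArc G) : R.walkLength (R.chiral v) = R.walkLength v := by
  refine Function.minimalPeriod_eq_minimalPeriod_iff.2 fun n => ?_
  have h : R.faceStep ^ n * R.chiral = R.chiral * (R.faceStep ^ n)⁻¹ := by
    rw [← inv_pow, ← R.chiral_conj, conj_pow]
    have h3 : R.chiral⁻¹ = R.chiral := by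
      ext1 u
      rw [Equiv.Perm.inv_eq_iff_eq]
      exact (R.chiral_chiral u).symm
    have h4 : R.chiral * R.chiral = 1 := by
      ext1 u
      exact R.chiral_chiral u
    rw [h3, ← mul_assoc, ← mul_assoc, h4, one_mul]
  rw [R.isPeriodicPt_iff, R.isPeriodicPt_iff, ← Equiv.Perm.mul_apply, h, Equiv.Perm.mul_apply,
    R.chiral.injective.eq_iff, Equiv.Perm.inv_eq_iff_eq, eq_comm]

/-- The length of a face. -/
noncomputable def faceLength : R.Face → ℕ :=
  Quotient.lift R.walkLength (by
    intro v w h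
    rcases h with h | h
    · exact R.walkLength_of_sameCycle h
    · rw [← R.walkLength_chiral v]
      exact R.walkLength_of_sameCycle h)

/-- A triangulation: every face is a triangle. -/
def IsTriangulation : Prop := ∀ f : R.Face, R.faceLength f = 3

/-- The self-intersections of the facial walk through `v`: the arcs `e` of `G` such that this walk
passes through `e` and also through the inverse arc. -/
def selfIntersections (v : CoverArc G) : Set G.Dart :=
  {e | (∃ k, R.faceStep.SameCycle v (e, k)) ∧ ∃ k, R.faceStep.SameCycle v (e.symm, k)}

/-- One step of the walk with the coin `C = !![a, b; c, d]`. At each vertex of the blow-up, and at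
each root of a tail, one island arc and one bridge or tail arc arrive; `a, b, c, d` are the weights
"island to island", "bridge to island", "island to bridge" and "bridge to the inverse bridge". A
bridge carries in addition the sign of its twist. The dynamics on the tails is free. -/
noncomputable def step (C : Matrix (Fin 2) (Fin 2) ℂ) (Ψ : WalkArc (CoverArc G) → ℂ) :
    WalkArc (CoverArc G) → ℂ
  | .quayIn u => C 0 0 * Ψ (.quayOut (R.coverRot.symm u)) + C 0 1 * Ψ (.bridge (R.coverRev u))
  | .quayOut u => C 0 0 * Ψ (.quayIn u) + C 0 1 * Ψ (.tailIn u 0)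
  | .bridge u => (-1) ^ (R.twist u.1).val *
      (C 1 0 * Ψ (.quayOut (R.coverRot.symm u)) + C 1 1 * Ψ (.bridge (R.coverRev u)))
  | .tailOut u 0 => C 1 0 * Ψ (.quayIn u) + C 1 1 * Ψ (.tailIn u 0)
  | .tailOut u (j + 1) => Ψ (.tailOut u j)
  | .tailIn u j => Ψ (.tailIn u (j + 1))

/-- The initial state of the inflow `α`: the value `α u` on every arc of the tail at `x_u` that
points inwards, and `0` elsewhere. -/
def initialState (α : CoverArc G → ℂ) : WalkArc (CoverArc G) → ℂ
  | .tailIn u _ => α u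
  | _ => 0

/-- The state at time `t`. -/
noncomputable def state (C : Matrix (Fin 2) (Fin 2) ℂ) (α : CoverArc G → ℂ) (t : ℕ) :
    WalkArc (CoverArc G) → ℂ :=
  (R.step C)^[t] (initialState α)

/-- The walk with inflow `α` converges on every arc. -/
def Converges (C : Matrix (Fin 2) (Fin 2) ℂ) (α : CoverArc G → ℂ) : Prop :=
  ∀ ξ : WalkArc (CoverArc G), ∃ z : ℂ, Tendsto (fun t => R.state C α t ξ) atTop (𝓝 z)

/-- The stationary state, the limit of the states on every arc. -/
noncomputable def stationary (C : Matrix (Fin 2) (Fin 2) ℂ) (α : CoverArc G → ℂ)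
    (ξ : WalkArc (CoverArc G)) : ℂ :=
  limUnder atTop (fun t => R.state C α t ξ)

section Comfort

variable [Fintype V] [DecidableEq V] [DecidableRel G.Adj]

/-- The comfortability on the islands: half the square norm of the stationary state restricted to
the island arcs. -/
noncomputable def islandComfort (C : Matrix (Fin 2) (Fin 2) ℂ) (α : CoverArc G → ℂ) : ℝ :=
  1 / 2 * ∑ u : CoverArc G,
    (‖R.stationary C α (.quayIn u)‖ ^ 2 + ‖R.stationary C α (.quayOut u)‖ ^ 2)

/-- The comfortability on the bridges. -/
noncomputable def bridgeComfort (C : Matrix (Fin 2) (Fin 2) ℂ) (α : CoverArc G → ℂ) : ℝ :=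
  1 / 2 * ∑ u : CoverArc G, ‖R.stationary C α (.bridge u)‖ ^ 2

/-- The comfortability: half the square norm of the stationary state restricted to the internal
graph. -/
noncomputable def comfort (C : Matrix (Fin 2) (Fin 2) ℂ) (α : CoverArc G → ℂ) : ℝ :=
  R.islandComfort C α + R.bridgeComfort C α

/-- The average of the comfortability over the inflows `1` from a single tail, chosen uniformly. -/
noncomputable def meanComfort (C : Matrix (Fin 2) (Fin 2) ℂ) : ℝ :=
  (∑ u : CoverArc G, R.comfort C (Pi.single u 1)) / Fintype.card (CoverArc G)

/-- The average of the comfortability on the islands. -/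
noncomputable def meanIslandComfort (C : Matrix (Fin 2) (Fin 2) ℂ) : ℝ :=
  (∑ u : CoverArc G, R.islandComfort C (Pi.single u 1)) / Fintype.card (CoverArc G)

/-- `L` is the limit of `δ ^ 2` times the average comfortability as `δ ↓ 0`, where `a = 1 - δ`,
whatever coins with this `a` are used. -/
def HasLimitComfort (L : ℝ) : Prop :=
  ∀ C : ℝ → Matrix (Fin 2) (Fin 2) ℂ, (∀ δ : ℝ, 0 < δ → δ < 1 → IsCoin (C δ) (1 - δ)) →
    Tendsto (fun δ => δ ^ 2 * R.meanComfort (C δ)) (𝓝[>] 0) (𝓝 L)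

/-- The best embedding of `G` as `a → 1`: it gives the most comfortability in all the embeddings of
`G`, measured by the limit of the scaled average comfortability, which exists for all of them. -/
def IsBest : Prop :=
  ∃ L : ℝ, R.HasLimitComfort L ∧
    ∀ R' : RotationSystem G, ∃ L' : ℝ, R'.HasLimitComfort L' ∧ L' ≤ L

noncomputable instance : Fintype R.Face :=
  letI : Finite R.Face := inferInstanceAs (Finite (Quotient R.faceSetoid))
  Fintype.ofFinite _

/-- The multiset of the lengths of all faces. -/
noncomputable def faceLengths : Multiset ℕ :=
  (Finset.univ : Finset R.Face).val.map R.faceLength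

end Comfort

end RotationSystem

end EmbeddedWalk

namespace EmbeddedWalk

/-! The stationary state is explicit and is carried by the facial walks. Up to the factor `b` and
the sign of the sheet, which absorbs the signs of the twisted bridges, the island amplitude `p`
solves p(u) = a p(φ⁻¹ u) + sign(u) α(u) with φ = `faceStep`: it runs along the facial walk and is
damped by a at each step (`profile_eq`, `step_limitState`). The walk converges to this state because
without inflow the tails drain the internal energy (`tendsto_zero_of_step`).

For a unit inflow on a facial walk of length n, p is a geometric series along that walk. The island
comfortability is then exactly (1 + a^n) / (1 - a^n), which decreases in n. Scaled by δ², the island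
part vanishes as a → 1, and the bridge part tends to ½ ∑ (x_u - y_u)² / n², where x_u and y_u in {0,
1} tell whether the walk passes through the reversal of u and through u. Since (x - y)² ≤ x + y,
with equality unless x = y = 1, this limit is at most 1/n, and it equals 1/n if the walk never
contains an arc of the cover together with its reversal (`scaledComfort_le`).

A triangulation attains the bound with n = 3, because a closed walk of three steps through an arc
and its inverse would contain a loop (`sameCycle_ne`). No other embedding has n < 3: such a walk
needs an edge whose two ends have degree one, which is a property of G and would give the
triangulation a short walk as well (`three_le_walkLength`). The statement on partitions is the same
monotonicity in n, combined with the fact that the face lengths sum to |A|; the latter holds because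
a facial walk and its inverse are always distinct cycles (`not_sameCycle_chiral`). -/

/-- The response at `u` to a unit source at `v` that is transported by `φ` with damping `a`. -/
noncomputable def response {X : Type*} [DecidableEq X] (φ : Equiv.Perm X) (a : ℝ) (v u : X) : ℝ :=
  (∑ j ∈ Finset.range (Function.minimalPeriod φ v), if (φ ^ j) v = u then a ^ j else 0) /
    (1 - a ^ Function.minimalPeriod φ v)

/-- The number of visits to `u` among the first `n` points of the `φ`-orbit of `v`. -/
def visits {X : Type*} [DecidableEq X] (φ : Equiv.Perm X) (v u : X) (n : ℕ) : ℝ :=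
  ∑ j ∈ Finset.range n, if (φ ^ j) v = u then 1 else 0

/-! ### Orbits of a permutation and damped transport along them -/

section Period

variable {X : Type*} (φ : Equiv.Perm X)

lemma minimalPeriod_pos_of_finite [Finite X] (v : X) : 0 < Function.minimalPeriod φ v :=
  Function.minimalPeriod_pos_of_mem_periodicPts
    (Function.Injective.mem_periodicPts φ.injective v)

lemma pow_minimalPeriod_apply (v : X) : (φ ^ Function.minimalPeriod φ v) v = v := by
  rw [← Equiv.Perm.iterate_eq_pow]
  exact Function.iterate_minimalPeriod

lemma pow_apply_inj_of_lt {v : X} {i j : ℕ} (hi : i < Function.minimalPeriod φ v)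
    (hj : j < Function.minimalPeriod φ v) (h : (φ ^ i) v = (φ ^ j) v) : i = j := by
  rw [← Equiv.Perm.iterate_eq_pow, ← Equiv.Perm.iterate_eq_pow] at h
  exact (Function.iterate_eq_iterate_iff_of_lt_minimalPeriod hi hj).1 h

end Period

section Response

variable {X : Type*} [DecidableEq X] (φ : Equiv.Perm X)

/-- Telescoping over one period: shifting the index by one moves the target from `u` to `φ.symm u`,
and the boundary term a^n - 1, present only for u = v, cancels the denominator. -/
lemma response_eq {a : ℝ} {v : X} (ha : a ^ Function.minimalPeriod φ v ≠ 1) (u : X) :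
    response φ a v u = a * response φ a v (φ.symm u) + if u = v then 1 else 0 := by
  have hn : 1 - a ^ Function.minimalPeriod φ v ≠ 0 := sub_ne_zero.2 ha.symm
  have h := Finset.sum_range_sub (fun j => if (φ ^ j) v = u then a ^ j else 0)
    (Function.minimalPeriod φ v)
  have h1 : ∀ j : ℕ, (φ ^ (j + 1)) v = u ↔ (φ ^ j) v = φ.symm u := fun j => by
    rw [pow_succ', Equiv.Perm.mul_apply, Equiv.eq_symm_apply]
  simp only [h1, Finset.sum_sub_distrib, pow_minimalPeriod_apply, pow_zero,
    Equiv.Perm.one_apply] at h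
  have h2 : ∑ j ∈ Finset.range (Function.minimalPeriod φ v),
      (if (φ ^ j) v = φ.symm u then a ^ (j + 1) else 0) =
      a * ∑ j ∈ Finset.range (Function.minimalPeriod φ v),
        if (φ ^ j) v = φ.symm u then a ^ j else 0 := by
    rw [Finset.mul_sum]
    refine Finset.sum_congr rfl fun j _ => ?_
    split_ifs <;> ring
  rw [h2] at h
  rw [response, response]
  field_simp
  by_cases huv : u = v
  · subst huv
    simp only [if_true] at h ⊢
    linarith
  · rw [if_neg (Ne.symm huv), if_neg (Ne.symm huv)] at h
    rw [if_neg huv]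
    linarith

lemma response_self [Finite X] (a : ℝ) (v : X) :
    response φ a v v = 1 / (1 - a ^ Function.minimalPeriod φ v) := by
  have hpos := minimalPeriod_pos_of_finite φ v
  rw [response, Finset.sum_eq_single_of_mem 0 (Finset.mem_range.2 hpos)]
  · simp
  · intro j hj hj0
    refine if_neg fun h => hj0 ?_
    exact pow_apply_inj_of_lt φ (Finset.mem_range.1 hj) hpos (by simpa using h)

/-- Square the recursion and sum over `u`. As φ permutes the points, the sum reappears with factor
a², and the cross term survives only at u = v, where the recursion evaluates it. -/
lemma sum_response_sq [Fintype X] {a : ℝ} {v : X} (ha : a ^ Function.minimalPeriod φ v ≠ 1) :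
    (1 - a ^ 2) * ∑ u, response φ a v u ^ 2 =
      (1 + a ^ Function.minimalPeriod φ v) / (1 - a ^ Function.minimalPeriod φ v) := by
  have hn : 1 - a ^ Function.minimalPeriod φ v ≠ 0 := sub_ne_zero.2 ha.symm
  have h1 : ∀ u, response φ a v u ^ 2 = a ^ 2 * response φ a v (φ.symm u) ^ 2 +
      if u = v then 2 * (a * response φ a v (φ.symm v)) + 1 else 0 := fun u => by
    rw [response_eq φ ha u]
    split_ifs with huv
    · subst huv; ring
    · ring
  have h2 : ∑ u, response φ a v u ^ 2 = a ^ 2 * ∑ u, response φ a v u ^ 2 +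
      (2 * (a * response φ a v (φ.symm v)) + 1) := by
    conv_lhs => rw [Finset.sum_congr rfl fun u _ => h1 u]
    rw [Finset.sum_add_distrib, ← Finset.mul_sum,
      Equiv.sum_comp φ.symm (fun u => response φ a v u ^ 2)]
    simp
  have h3 := response_eq φ ha v
  rw [if_pos rfl, response_self] at h3
  have h4 : a * response φ a v (φ.symm v) = 1 / (1 - a ^ Function.minimalPeriod φ v) - 1 := by
    linarith
  rw [h4] at h2
  have h5 : (1 + a ^ Function.minimalPeriod φ v) / (1 - a ^ Function.minimalPeriod φ v) =
      2 * (1 / (1 - a ^ Function.minimalPeriod φ v)) - 1 := by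
    field_simp; ring
  rw [h5]
  linarith

lemma tendsto_mul_response [Finite X] (v u : X) :
    Tendsto (fun δ : ℝ => δ * response φ (1 - δ) v u) (𝓝[>] 0)
      (𝓝 (visits φ v u (Function.minimalPeriod φ v) / Function.minimalPeriod φ v)) := by
  have hpos := minimalPeriod_pos_of_finite φ v
  set n := Function.minimalPeriod φ v with hn
  -- The factor δ cancels the simple zero of 1 - (1 - δ)^n at δ = 0; what remains is continuous,
  -- with denominator tending to n.
  have hgeom : ∀ δ : ℝ, (∑ i ∈ Finset.range n, (1 - δ) ^ i) * δ = 1 - (1 - δ) ^ n := fun δ => by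
    have := geom_sum_mul_neg (1 - δ) n
    simpa using this
  have hcont : Tendsto (fun δ : ℝ => (∑ j ∈ Finset.range n,
      if (φ ^ j) v = u then (1 - δ) ^ j else 0) / ∑ i ∈ Finset.range n, (1 - δ) ^ i) (𝓝 0)
      (𝓝 (visits φ v u n / n)) := by
    have hnum : Tendsto (fun δ : ℝ => ∑ j ∈ Finset.range n,
        if (φ ^ j) v = u then (1 - δ) ^ j else 0) (𝓝 0) (𝓝 (visits φ v u n)) := by
      refine tendsto_finsetSum _ fun j _ => ?_
      split_ifs
      · have : Continuous fun δ : ℝ => (1 - δ) ^ j := by fun_prop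
        simpa using this.tendsto 0
      · exact tendsto_const_nhds
    have hden : Tendsto (fun δ : ℝ => ∑ i ∈ Finset.range n, (1 - δ) ^ i) (𝓝 0) (𝓝 (n : ℝ)) := by
      have : Continuous fun δ : ℝ => ∑ i ∈ Finset.range n, (1 - δ) ^ i := by fun_prop
      simpa using this.tendsto 0
    exact hnum.div hden (by exact_mod_cast hpos.ne')
  refine (hcont.mono_left nhdsWithin_le_nhds).congr' ?_
  filter_upwards [self_mem_nhdsWithin] with δ hδ
  have hδ0 : δ ≠ 0 := ne_of_gt hδ
  rw [response, ← hn, ← hgeom δ, ← mul_div_assoc, mul_comm δ, mul_div_mul_right _ _ hδ0]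

lemma visits_eq [Finite X] (v u : X) [Decidable (φ.SameCycle v u)] :
    visits φ v u (Function.minimalPeriod φ v) = if φ.SameCycle v u then 1 else 0 := by
  have hpos := minimalPeriod_pos_of_finite φ v
  split_ifs with h
  · obtain ⟨i, hi⟩ := h.exists_nat_pow_eq
    rw [← Equiv.Perm.iterate_eq_pow, ← Function.iterate_mod_minimalPeriod_eq,
      Equiv.Perm.iterate_eq_pow] at hi
    have hlt := Nat.mod_lt i hpos
    rw [visits, Finset.sum_eq_single_of_mem _ (Finset.mem_range.2 hlt), if_pos hi]
    intro j hj hne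
    exact if_neg fun hj' => hne (pow_apply_inj_of_lt φ (Finset.mem_range.1 hj) hlt (hj'.trans hi.symm))
  · refine Finset.sum_eq_zero fun j _ => if_neg fun hj => h ⟨j, ?_⟩
    simpa using hj

lemma sum_visits [Fintype X] (v : X) (n : ℕ) : ∑ u, visits φ v u n = n := by
  simp only [visits]
  rw [Finset.sum_comm]
  simp

open Classical in
lemma card_sameCycle [Fintype X] (v : X) :
    (Finset.univ.filter fun u => φ.SameCycle v u).card = Function.minimalPeriod φ v := by
  have h := sum_visits φ v (Function.minimalPeriod φ v)
  simp only [visits_eq φ v] at h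
  rw [Finset.sum_boole] at h
  exact_mod_cast h

end Response

/-! ### Facial walks: short walks, triangles and the inverse walk -/

namespace RotationSystem

variable {V : Type*} {G : SimpleGraph V} (R : RotationSystem G)

lemma coverRot_snd (v : CoverArc G) : (R.coverRot v).1.snd = v.1.snd := by
  have h := R.rot_snd (R.rot.symm v.1)
  rw [Equiv.apply_symm_apply] at h
  by_cases hk : v.2 = 0
  · simpa [coverRot, hk] using R.rot_snd v.1
  · simpa [coverRot, hk] using h.symm

lemma faceStep_fst (v : CoverArc G) : (R.faceStep v).1.fst = v.1.snd := R.coverRot_snd v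

lemma coverRev_coverRev (v : CoverArc G) : R.coverRev (R.coverRev v) = v := R.coverRev.left_inv v

lemma faceStep_symm_coverRev (v : CoverArc G) :
    R.faceStep.symm (R.coverRev v) = R.coverRot.symm v :=
  congrArg R.coverRot.symm (R.coverRev_coverRev v)

lemma coverRot_fst_eq_iff (v : CoverArc G) : (R.coverRot v).1 = v.1 ↔ R.rot v.1 = v.1 := by
  by_cases hk : v.2 = 0
  · simp [coverRot, hk]
  · simp only [coverRot, hk, Equiv.coe_fn_mk, if_false]
    rw [Equiv.symm_apply_eq, eq_comm]

/-- A closed walk of two steps goes forth and back along one edge, since in a simple graph the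
endpoints determine the arc; the rotation has then returned the arc itself. -/
lemma rot_eq_self_of_faceStep {v : CoverArc G} (h : R.faceStep (R.faceStep v) = v) :
    R.rot v.1 = v.1 := by
  have h1 : (R.faceStep v).1 = v.1.symm := by
    have h2 := R.faceStep_fst v
    have h3 := R.faceStep_fst (R.faceStep v)
    rw [h] at h3
    ext
    · exact h2
    · exact h3.symm
  rw [← R.coverRot_fst_eq_iff]
  exact SimpleGraph.Dart.symm_involutive.injective h1

lemma faceStep_of_rot_eq_self {v : CoverArc G} (h : R.rot v.1 = v.1) :
    R.faceStep v = R.coverRev v := by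
  refine congrArg R.coverRev (Prod.ext ((R.coverRot_fst_eq_iff v).2 h) rfl)

/-- A fixed point of a rotation that is cyclic at each vertex is the only arc ending there, which
does not depend on the embedding. -/
lemma rot_eq_self_congr (R' : RotationSystem G) {e : G.Dart} (h : R.rot e = e) : R'.rot e = e :=
  ((R.rot_cyclic e (R'.rot e) (R'.rot_snd e).symm).eq_of_left h).symm

lemma faceStep_faceStep_eq_self_congr (R' : RotationSystem G) {v : CoverArc G}
    (h : R.faceStep (R.faceStep v) = v) : R'.faceStep (R'.faceStep v) = v := by
  have h1 := R.rot_eq_self_of_faceStep h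
  have h2 : R.rot v.1.symm = v.1.symm := by
    have h3 := R.rot_eq_self_of_faceStep (v := R.faceStep v) (by rw [h])
    rw [R.faceStep_of_rot_eq_self h1] at h3
    exact h3
  rw [R'.faceStep_of_rot_eq_self (R.rot_eq_self_congr R' h1),
    R'.faceStep_of_rot_eq_self (R.rot_eq_self_congr R' h2), R'.coverRev_coverRev]

variable {R} in
lemma IsTriangulation.walkLength_eq (hR : R.IsTriangulation) (v : CoverArc G) :
    R.walkLength v = 3 :=
  hR (Quotient.mk R.faceSetoid v)

variable {R} in
lemma IsTriangulation.faceStep_three (hR : R.IsTriangulation) (v : CoverArc G) :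
    R.faceStep (R.faceStep (R.faceStep v)) = v := by
  have h := pow_minimalPeriod_apply R.faceStep v
  rw [show Function.minimalPeriod R.faceStep v = 3 from hR.walkLength_eq v] at h
  exact h

/-- If `G` has a triangulation, then every embedding of `G` has facial walks of length at least
three. -/
lemma IsTriangulation.three_le_walkLength [Finite V] {T : RotationSystem G}
    (hT : T.IsTriangulation) (v : CoverArc G) : 3 ≤ R.walkLength v := by
  have hpos : 0 < R.walkLength v := by
    classical
    have : Fintype V := Fintype.ofFinite V
    have : Finite (CoverArc G) := inferInstance
    exact minimalPeriod_pos_of_finite R.faceStep v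
  by_contra hlt
  have h2 : R.walkLength v ∣ 2 := by
    have : R.walkLength v = 1 ∨ R.walkLength v = 2 := by omega
    rcases this with h | h <;> simp [h]
  have h3 : R.faceStep (R.faceStep v) = v :=
    Function.isPeriodicPt_iff_minimalPeriod_dvd.2 h2
  have h4 := R.faceStep_faceStep_eq_self_congr T h3
  have h5 : T.walkLength v ∣ 2 := Function.IsPeriodicPt.minimalPeriod_dvd (n := 2) h4
  rw [hT.walkLength_eq v] at h5
  omega

variable {R} in
-- Consecutive arcs share a vertex. If a closed walk of three steps contains an arc and its inverse,
-- its remaining arc starts and ends at the same vertex.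
lemma IsTriangulation.sameCycle_ne [Finite V] (hR : R.IsTriangulation) {v w : CoverArc G}
    (h : R.faceStep.SameCycle v w) : w.1 ≠ v.1.symm := by
  intro hw
  classical
  have : Fintype V := Fintype.ofFinite V
  obtain ⟨i, hi⟩ := h.exists_nat_pow_eq
  rw [← Equiv.Perm.iterate_eq_pow, ← Function.iterate_mod_minimalPeriod_eq,
    show Function.minimalPeriod R.faceStep v = 3 from hR.walkLength_eq v] at hi
  have hlt := Nat.mod_lt i (show 3 > 0 by norm_num)
  have h3 := hR.faceStep_three v
  have f1 := R.faceStep_fst v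
  have f2 := R.faceStep_fst (R.faceStep v)
  have f3 := R.faceStep_fst (R.faceStep (R.faceStep v))
  rw [h3] at f3
  generalize i % 3 = j at hi hlt
  interval_cases j
  · change v = w at hi
    rw [← hi] at hw
    exact v.1.symm_ne hw.symm
  · change R.faceStep v = w at hi
    rw [hi, hw] at f2
    exact (R.faceStep (R.faceStep v)).1.fst_ne_snd (by rw [hi] at f3 ⊢; exact f2.trans f3)
  · change R.faceStep (R.faceStep v) = w at hi
    rw [hi, hw] at f2
    exact (R.faceStep v).1.fst_ne_snd (f1.trans f2)

variable {R} in
lemma IsTriangulation.selfIntersections_eq_empty [Finite V] (hR : R.IsTriangulation)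
    (v : CoverArc G) : R.selfIntersections v = ∅ := by
  refine Set.eq_empty_of_forall_notMem ?_
  rintro e ⟨⟨k, hk⟩, l, hl⟩
  exact hR.sameCycle_ne (hk.symm.trans hl) rfl

lemma chiral_ne_self (v : CoverArc G) : R.chiral v ≠ v := fun h =>
  v.1.symm_ne (congrArg Prod.fst h)

/-- Before the common reversal, one side has changed the sheet and the other has not. -/
lemma chiral_ne_faceStep (v : CoverArc G) : R.chiral v ≠ R.faceStep v := by
  intro h
  have h1 : R.chiral v = R.coverRev (v.1, v.2 + 1) := by
    refine Prod.ext rfl ?_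
    change v.2 + R.twist v.1 + 1 = v.2 + 1 + R.twist v.1
    ring
  rw [h1] at h
  have h2 := congrArg Prod.snd (R.coverRev.injective h)
  change v.2 + 1 = v.2 at h2
  simp at h2

lemma chiral_faceStep_zpow (v : CoverArc G) (m : ℤ) :
    R.chiral ((R.faceStep ^ m) v) = (R.faceStep ^ (-m)) (R.chiral v) := by
  have h : R.chiral * R.faceStep ^ m = R.faceStep ^ (-m) * R.chiral := by
    rw [zpow_neg, ← inv_zpow, ← R.chiral_conj, conj_zpow]
    group
  exact DFunLike.congr_fun h v

/-- No directed facial walk agrees with its chiral copy. -/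
lemma not_sameCycle_chiral (v : CoverArc G) : ¬ R.faceStep.SameCycle v (R.chiral v) := by
  rintro ⟨i, hi⟩
  have h : ∀ m : ℤ, R.chiral ((R.faceStep ^ m) v) = (R.faceStep ^ (i - m)) v := fun m => by
    rw [chiral_faceStep_zpow, ← hi, ← Equiv.Perm.mul_apply, ← zpow_add]
    congr 2
    ring
  -- On its own cycle the inversion would act as the reflection m ↦ i - m, which fixes a point if i
  -- is even and exchanges two neighbours if i is odd.
  obtain ⟨m, rfl | rfl⟩ := Int.even_or_odd' i
  · refine R.chiral_ne_self ((R.faceStep ^ m) v) ?_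
    rw [h]
    congr 2
    ring
  · refine R.chiral_ne_faceStep ((R.faceStep ^ m) v) ?_
    rw [h, ← Equiv.Perm.mul_apply, ← zpow_one_add]
    congr 2
    ring

/-- The face with the facial walk through `v`. -/
def faceOf (v : CoverArc G) : R.Face := Quotient.mk R.faceSetoid v

lemma faceOf_eq_iff {v w : CoverArc G} :
    R.faceOf v = R.faceOf w ↔ R.faceStep.SameCycle v w ∨ R.faceStep.SameCycle (R.chiral v) w :=
  Quotient.eq (r := R.faceSetoid)

/-! ### Counting arcs by faces -/

section Count

variable [Fintype V] [DecidableEq V] [DecidableRel G.Adj]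

omit [DecidableEq V] in
variable {R} in
lemma IsTriangulation.eq_three_of_mem_faceLengths (hR : R.IsTriangulation) {n : ℕ}
    (hn : n ∈ R.faceLengths) : n = 3 := by
  obtain ⟨f, -, rfl⟩ := Multiset.mem_map.1 hn
  exact hR f

open Classical in
-- A face consists of two disjoint cycles of equal length, a facial walk and its chiral copy.
lemma card_fiber_faceOf (f : R.Face) :
    (Finset.univ.filter fun w : CoverArc G => R.faceOf w = f).card = 2 * R.faceLength f := by
  obtain ⟨v, rfl⟩ : ∃ v, R.faceOf v = f := Quotient.exists_rep f
  have h : (Finset.univ.filter fun w : CoverArc G => R.faceOf w = R.faceOf v) =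
      (Finset.univ.filter fun w => R.faceStep.SameCycle v w) ∪
        Finset.univ.filter fun w => R.faceStep.SameCycle (R.chiral v) w := by
    ext w
    simp only [Finset.mem_filter, Finset.mem_univ, true_and, Finset.mem_union]
    rw [eq_comm, R.faceOf_eq_iff]
  rw [h, Finset.card_union_of_disjoint, card_sameCycle, card_sameCycle]
  · have h1 := R.walkLength_chiral v
    change R.walkLength v + R.walkLength (R.chiral v) = 2 * R.walkLength v
    omega
  · rw [Finset.disjoint_filter]
    exact fun w _ h1 h2 => R.not_sameCycle_chiral v (h1.trans h2.symm)

lemma sum_faceLengths : R.faceLengths.sum = Fintype.card G.Dart := by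
  classical
  have h := Finset.card_eq_sum_card_fiberwise (s := (Finset.univ : Finset (CoverArc G)))
    (t := (Finset.univ : Finset R.Face)) (f := R.faceOf)
    (fun _ _ => Finset.mem_coe.2 (Finset.mem_univ _))
  rw [Finset.sum_congr rfl fun f _ => R.card_fiber_faceOf f, ← Finset.mul_sum, Finset.card_univ,
    Fintype.card_prod, ZMod.card] at h
  change ∑ f : R.Face, R.faceLength f = _
  omega

end Count

end RotationSystem

/-! ### The coin has the form (a, b; b̄, -a) -/

section Coin

variable {C : Matrix (Fin 2) (Fin 2) ℂ} {a : ℝ}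

lemma IsCoin.normSq_entry (hC : IsCoin C a) : Complex.normSq (C 0 1) = 1 - a ^ 2 := by
  have h := congrFun (congrFun (Matrix.mem_unitaryGroup_iff.1 hC.unitary) 0) 0
  simp only [Matrix.mul_apply, Fin.sum_univ_two, Matrix.star_apply, Matrix.one_apply_eq,
    hC.a_eq, RCLike.star_def, Complex.mul_conj, Complex.normSq_ofReal] at h
  have h' : a * a + Complex.normSq (C 0 1) = 1 := by exact_mod_cast h
  linarith

lemma IsCoin.entry_mul_star (hC : IsCoin C a) : C 0 1 * star (C 0 1) = 1 - (a : ℂ) ^ 2 := by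
  rw [RCLike.star_def, Complex.mul_conj, hC.normSq_entry]
  push_cast
  ring

lemma IsCoin.entry_one_one (hC : IsCoin C a) : C 1 1 = -(a : ℂ) := by
  have h2 := congrFun (congrFun (Matrix.mem_unitaryGroup_iff.1 hC.unitary) 0) 1
  simp only [Matrix.mul_apply, Fin.sum_univ_two, Matrix.star_apply, hC.a_eq] at h2
  rw [Matrix.one_apply_ne (by decide)] at h2
  have hd : star (C 1 1) = C 1 1 := Complex.conj_eq_iff_im.2 hC.d_real
  rw [hd] at h2
  have h3 := congrArg star h2
  rw [star_add, star_mul', star_mul', star_star, hd, star_zero, RCLike.star_def,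
    Complex.conj_ofReal] at h3
  have h4 := hC.omega_eq
  rw [Matrix.det_fin_two, hC.a_eq] at h4
  have h5 := hC.entry_mul_star
  rw [RCLike.star_def] at h5
  -- Eliminates bc between orthogonality of the rows and -det = 1, using |b|² = 1 - a².
  linear_combination C 0 1 * h3 - C 1 1 * h5 - a * h4

lemma IsCoin.entry_mul_entry (hC : IsCoin C a) : C 0 1 * C 1 0 = 1 - (a : ℂ) ^ 2 := by
  have h4 := hC.omega_eq
  rw [Matrix.det_fin_two, hC.a_eq, hC.entry_one_one] at h4
  linear_combination h4

lemma IsCoin.entry_ne_zero (hC : IsCoin C a) (ha : a ^ 2 < 1) : C 0 1 ≠ 0 := by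
  intro h
  have h1 := hC.normSq_entry
  rw [h, map_zero] at h1
  linarith

lemma IsCoin.entry_one_zero (hC : IsCoin C a) (ha : a ^ 2 < 1) : C 1 0 = star (C 0 1) :=
  mul_left_cancel₀ (hC.entry_ne_zero ha) (hC.entry_mul_entry.trans hC.entry_mul_star.symm)

lemma IsCoin.normSq_add_normSq (hC : IsCoin C a) (ha : a ^ 2 < 1) (x y : ℂ) :
    Complex.normSq (C 0 0 * x + C 0 1 * y) + Complex.normSq (C 1 0 * x + C 1 1 * y) =
      Complex.normSq x + Complex.normSq y := by
  have h := hC.normSq_entry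
  rw [hC.entry_one_zero ha, hC.entry_one_one, hC.a_eq]
  rw [Complex.normSq_apply] at h
  simp only [Complex.normSq_apply, Complex.add_re, Complex.add_im, Complex.mul_re, Complex.mul_im,
    RCLike.star_def, Complex.conj_re, Complex.conj_im, Complex.neg_re, Complex.neg_im,
    Complex.ofReal_re, Complex.ofReal_im]
  linear_combination (x.re ^ 2 + x.im ^ 2 + y.re ^ 2 + y.im ^ 2) * h

end Coin

/-! ### Convergence and the explicit stationary state -/

namespace RotationSystem

variable {V : Type*} {G : SimpleGraph V} (R : RotationSystem G)

/-- The sign of the sheet on which an arc of the double cover ends. -/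
def sheetSign (v : CoverArc G) : ℂ := (-1) ^ v.2.val

/-- The sign of the twist of an arc. -/
def twistSign (v : CoverArc G) : ℂ := (-1) ^ (R.twist v.1).val

lemma sheetSign_mul_self (v : CoverArc G) : sheetSign v * sheetSign v = 1 := by
  rw [sheetSign, ← mul_pow]
  simp

lemma twistSign_mul_self (v : CoverArc G) : R.twistSign v * R.twistSign v = 1 := by
  rw [twistSign, ← mul_pow]
  simp

lemma norm_sheetSign (v : CoverArc G) : ‖sheetSign v‖ = 1 := by simp [sheetSign]

lemma norm_twistSign (v : CoverArc G) : ‖R.twistSign v‖ = 1 := by simp [twistSign]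

lemma sheetSign_coverRot_symm (v : CoverArc G) : sheetSign (R.coverRot.symm v) = sheetSign v := rfl

lemma twistSign_coverRev (v : CoverArc G) : R.twistSign (R.coverRev v) = R.twistSign v :=
  congrArg (fun z : ZMod 2 => (-1 : ℂ) ^ z.val) (R.twist_symm v.1)

lemma sheetSign_coverRev (v : CoverArc G) :
    sheetSign (R.coverRev v) = sheetSign v * R.twistSign v := by
  have h : ∀ x y : ZMod 2, ((x + y).val + (x.val + y.val)) % 2 = 0 := by decide
  have h1 : (-1 : ℂ) ^ (v.2 + R.twist v.1).val * (-1) ^ (v.2.val + (R.twist v.1).val) = 1 := by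
    rw [← pow_add]
    exact Even.neg_one_pow (Nat.even_iff.2 (h _ _))
  have h2 : ((-1 : ℂ) ^ (v.2.val + (R.twist v.1).val)) * (-1) ^ (v.2.val + (R.twist v.1).val) =
      1 := by
    rw [← mul_pow]
    simp
  change (-1 : ℂ) ^ (v.2 + R.twist v.1).val = (-1) ^ v.2.val * (-1) ^ (R.twist v.1).val
  rw [← pow_add]
  linear_combination (-1 : ℂ) ^ (v.2.val + (R.twist v.1).val) * h1 -
    (-1 : ℂ) ^ (v.2 + R.twist v.1).val * h2

lemma step_sub (C : Matrix (Fin 2) (Fin 2) ℂ) (Ψ Φ : WalkArc (CoverArc G) → ℂ) :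
    R.step C (Ψ - Φ) = R.step C Ψ - R.step C Φ := by
  ext ξ
  rcases ξ with u | u | u | ⟨u, j⟩ | ⟨u, _ | j⟩ <;> simp only [step, Pi.sub_apply] <;> ring

section Finite

variable [Fintype V] [DecidableEq V] [DecidableRel G.Adj]

/-- The squared norm of the restriction of a state to the internal arcs. -/
noncomputable def internalEnergy (Ψ : WalkArc (CoverArc G) → ℂ) : ℝ :=
  ∑ u : CoverArc G, (Complex.normSq (Ψ (.quayIn u)) + Complex.normSq (Ψ (.quayOut u)) +
    Complex.normSq (Ψ (.bridge u)))

omit [DecidableEq V] in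
lemma internalEnergy_nonneg (Ψ : WalkArc (CoverArc G) → ℂ) : 0 ≤ internalEnergy Ψ :=
  Finset.sum_nonneg fun _ _ => add_nonneg (add_nonneg (Complex.normSq_nonneg _)
    (Complex.normSq_nonneg _)) (Complex.normSq_nonneg _)

omit [DecidableEq V] in
-- The coins preserve the norm, so without inflow energy leaves only at the roots of the tails,
-- where the fraction 1 - a² of each incoming island amplitude escapes.
lemma internalEnergy_step {C : Matrix (Fin 2) (Fin 2) ℂ} {a : ℝ} (hC : IsCoin C a)
    (ha : a ^ 2 < 1) {Ψ : WalkArc (CoverArc G) → ℂ} (hΨ : ∀ u, Ψ (.tailIn u 0) = 0) :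
    internalEnergy (R.step C Ψ) =
      internalEnergy Ψ - (1 - a ^ 2) * ∑ u : CoverArc G, Complex.normSq (Ψ (.quayIn u)) := by
  have h1 : ∀ u : CoverArc G, Complex.normSq (R.step C Ψ (.quayIn u)) +
      Complex.normSq (R.step C Ψ (.quayOut u)) + Complex.normSq (R.step C Ψ (.bridge u)) =
      Complex.normSq (Ψ (.quayOut (R.coverRot.symm u))) +
        Complex.normSq (Ψ (.bridge (R.coverRev u))) +
        a ^ 2 * Complex.normSq (Ψ (.quayIn u)) := fun u => by
    have h2 : Complex.normSq (R.step C Ψ (.bridge u)) = Complex.normSq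
        (C 1 0 * Ψ (.quayOut (R.coverRot.symm u)) + C 1 1 * Ψ (.bridge (R.coverRev u))) := by
      simp [step]
    have h3 : Complex.normSq (R.step C Ψ (.quayOut u)) =
        a ^ 2 * Complex.normSq (Ψ (.quayIn u)) := by
      simp [step, hΨ, hC.a_eq, sq]
    rw [h2, h3, ← hC.normSq_add_normSq ha (Ψ (.quayOut (R.coverRot.symm u)))]
    simp only [step]
    ring
  rw [internalEnergy, Finset.sum_congr rfl fun u _ => h1 u, internalEnergy]
  simp only [Finset.sum_add_distrib, ← Finset.mul_sum]
  rw [Equiv.sum_comp R.coverRot.symm fun u => Complex.normSq (Ψ (.quayOut u)),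
    Equiv.sum_comp R.coverRev fun u => Complex.normSq (Ψ (.bridge u))]
  ring

omit [DecidableEq V] in
/-- Without inflow the walk dies out on every arc. -/
lemma tendsto_zero_of_step {C : Matrix (Fin 2) (Fin 2) ℂ} {a : ℝ} (hC : IsCoin C a)
    (ha : a ^ 2 < 1) {D : ℕ → WalkArc (CoverArc G) → ℂ} (hstep : ∀ t, D (t + 1) = R.step C (D t))
    (hD : ∀ t u j, D t (.tailIn u j) = 0) (ξ : WalkArc (CoverArc G)) :
    Tendsto (fun t => D t ξ) atTop (𝓝 0) := by
  have hE : ∀ t, internalEnergy (D (t + 1)) = internalEnergy (D t) -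
      (1 - a ^ 2) * ∑ u : CoverArc G, Complex.normSq (D t (.quayIn u)) := fun t => by
    rw [hstep]
    exact R.internalEnergy_step hC ha fun u => hD t u 0
  have hpos : 0 < 1 - a ^ 2 := by linarith
  have hanti : Antitone fun t => internalEnergy (D t) := antitone_nat_of_succ_le fun t => by
    rw [hE]
    have : 0 ≤ ∑ u : CoverArc G, Complex.normSq (D t (.quayIn u)) :=
      Finset.sum_nonneg fun _ _ => Complex.normSq_nonneg _
    nlinarith
  obtain ⟨l, hl⟩ : ∃ l, Tendsto (fun t => internalEnergy (D t)) atTop (𝓝 l) :=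
    ⟨_, tendsto_atTop_ciInf hanti ⟨0, by rintro _ ⟨t, rfl⟩; exact internalEnergy_nonneg _⟩⟩
  -- The energy decreases and is bounded below, so the loss per step tends to 0.
  have hsum : Tendsto (fun t => ∑ u : CoverArc G, Complex.normSq (D t (.quayIn u))) atTop
      (𝓝 0) := by
    have h1 := ((hl.sub (hl.comp (tendsto_add_atTop_nat 1))).const_mul (1 - a ^ 2)⁻¹)
    rw [sub_self, mul_zero] at h1
    refine h1.congr fun t => ?_
    simp only [Function.comp_apply, hE]
    field_simp
    ring
  have hIn : ∀ u, Tendsto (fun t => D t (.quayIn u)) atTop (𝓝 0) := fun u => by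
    have h1 : Tendsto (fun t => Complex.normSq (D t (.quayIn u))) atTop (𝓝 0) :=
      squeeze_zero (fun t => Complex.normSq_nonneg _)
        (fun t => Finset.single_le_sum (f := fun u => Complex.normSq (D t (.quayIn u)))
          (fun u _ => Complex.normSq_nonneg _) (Finset.mem_univ u)) hsum
    rw [tendsto_zero_iff_norm_tendsto_zero]
    have h2 := h1.sqrt
    rw [Real.sqrt_zero] at h2
    exact h2
  have hOut : ∀ u, Tendsto (fun t => D t (.quayOut u)) atTop (𝓝 0) := fun u => by
    rw [← tendsto_add_atTop_iff_nat 1]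
    have h1 := (hIn u).const_mul (C 0 0)
    rw [mul_zero] at h1
    refine h1.congr fun t => ?_
    rw [hstep]
    simp [step, hD]
  -- As b ≠ 0, the bridge amplitude is recovered from the island amplitudes by solving the update
  -- rule of `quayIn`.
  have hBridge : ∀ u, Tendsto (fun t => D t (.bridge u)) atTop (𝓝 0) := fun u => by
    have h1 := (((hIn (R.coverRev u)).comp (tendsto_add_atTop_nat 1)).sub
      ((hOut (R.coverRot.symm (R.coverRev u))).const_mul (C 0 0))).const_mul (C 0 1)⁻¹
    rw [mul_zero, sub_zero, mul_zero] at h1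
    refine h1.congr fun t => ?_
    have hb := hC.entry_ne_zero ha
    simp only [Function.comp_apply, hstep, step, R.coverRev_coverRev]
    field_simp
    ring
  rcases ξ with u | u | u | ⟨u, j⟩ | ⟨u, j⟩
  · exact hIn u
  · exact hOut u
  · exact hBridge u
  · simp [hD]
  · induction j with
    | zero =>
      rw [← tendsto_add_atTop_iff_nat 1]
      have h1 := (hIn u).const_mul (C 1 0)
      rw [mul_zero] at h1
      refine h1.congr fun t => ?_
      rw [hstep]
      simp [step, hD]
    | succ j ih =>
      rw [← tendsto_add_atTop_iff_nat 1]
      exact ih.congr fun t => by rw [hstep]; rfl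

/-- The stationary amplitude on the islands, up to the sign of the sheet and the factor `b`. -/
noncomputable def profile (a : ℝ) (α : CoverArc G → ℂ) (u : CoverArc G) : ℂ :=
  ∑ v, sheetSign v * α v * (response R.faceStep a v u : ℂ)

lemma profile_eq {a : ℝ} (h0 : 0 < a) (h1 : a < 1) (α : CoverArc G → ℂ) (u : CoverArc G) :
    R.profile a α u = a * R.profile a α (R.faceStep.symm u) + sheetSign u * α u := by
  have h2 : ∀ v, (response R.faceStep a v u : ℂ) =
      a * (response R.faceStep a v (R.faceStep.symm u) : ℂ) + if u = v then 1 else 0 := fun v => by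
    rw [response_eq R.faceStep
      (pow_lt_one₀ h0.le h1 (minimalPeriod_pos_of_finite R.faceStep v).ne').ne u]
    split_ifs <;> simp
  rw [profile, Finset.sum_congr rfl fun v _ => by rw [h2 v, mul_add], Finset.sum_add_distrib,
    profile, Finset.mul_sum]
  congr 1
  · exact Finset.sum_congr rfl fun v _ => by ring
  · simp

lemma profile_single (a : ℝ) (v u : CoverArc G) :
    R.profile a (Pi.single v 1) u = sheetSign v * (response R.faceStep a v u : ℂ) := by
  rw [profile, Finset.sum_eq_single v]
  · simp
  · intro w _ hw
    simp [hw]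
  · simp

/-- The explicit stationary state. -/
noncomputable def limitState (C : Matrix (Fin 2) (Fin 2) ℂ) (a : ℝ) (α : CoverArc G → ℂ) :
    WalkArc (CoverArc G) → ℂ
  | .quayIn u => C 0 1 * (sheetSign u * R.profile a α (R.faceStep.symm u))
  | .quayOut u => C 0 1 * (sheetSign u * R.profile a α u)
  | .bridge u => R.twistSign u * sheetSign u *
      (R.profile a α (R.faceStep.symm (R.coverRev u)) - a * R.profile a α (R.faceStep.symm u))
  | .tailIn u _ => α u
  | .tailOut u _ => C 1 0 * (C 0 1 * (sheetSign u * R.profile a α (R.faceStep.symm u))) +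
      C 1 1 * α u

/-- The bridge amplitude is chosen so that the term a p(ρ⁻¹ u) reflected back into the island
cancels. What enters at `u` then comes entirely from across the bridge, that is, from φ⁻¹ u. -/
lemma step_limitState {C : Matrix (Fin 2) (Fin 2) ℂ} {a : ℝ} (hC : IsCoin C a) (h0 : 0 < a)
    (h1 : a < 1) (α : CoverArc G → ℂ) : R.step C (R.limitState C a α) = R.limitState C a α := by
  ext ξ
  rcases ξ with u | u | u | ⟨u, j⟩ | ⟨u, _ | j⟩
  · simp only [step, limitState, R.coverRev_coverRev, R.faceStep_symm_coverRev,
      R.twistSign_coverRev, R.sheetSign_coverRev, R.sheetSign_coverRot_symm, hC.a_eq]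
    linear_combination C 0 1 * sheetSign u * (R.profile a α (R.faceStep.symm u) -
      a * R.profile a α (R.coverRot.symm u)) * R.twistSign_mul_self u
  · simp only [step, limitState, hC.a_eq, R.profile_eq h0 h1 α u]
    linear_combination -C 0 1 * α u * sheetSign_mul_self u
  · simp only [step, limitState, R.coverRev_coverRev, R.faceStep_symm_coverRev,
      R.twistSign_coverRev, R.sheetSign_coverRev, R.sheetSign_coverRot_symm, hC.entry_one_one]
    change R.twistSign u * _ = _
    linear_combination R.twistSign u * sheetSign u * R.profile a α (R.coverRot.symm u) *
      hC.entry_mul_entry - a * R.twistSign u * sheetSign u *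
      (R.profile a α (R.faceStep.symm u) - a * R.profile a α (R.coverRot.symm u)) *
      R.twistSign_mul_self u
  · rfl
  · rfl
  · rfl

/-- The inflow on the tails is constant in time, so the difference from the fixed point has no
inflow and dies out. -/
lemma tendsto_state {C : Matrix (Fin 2) (Fin 2) ℂ} {a : ℝ} (hC : IsCoin C a) (h0 : 0 < a)
    (h1 : a < 1) (α : CoverArc G → ℂ) (ξ : WalkArc (CoverArc G)) :
    Tendsto (fun t => R.state C α t ξ) atTop (𝓝 (R.limitState C a α ξ)) := by
  have hsucc : ∀ t, R.state C α (t + 1) = R.step C (R.state C α t) := fun t =>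
    Function.iterate_succ_apply' _ _ _
  have htail : ∀ t u j, R.state C α t (.tailIn u j) = α u := fun t => by
    induction t with
    | zero => exact fun _ _ => rfl
    | succ t ih =>
      intro u j
      rw [hsucc]
      exact ih u (j + 1)
  have h := R.tendsto_zero_of_step hC (by nlinarith)
    (D := fun t => R.state C α t - R.limitState C a α)
    (fun t => by rw [step_sub, R.step_limitState hC h0 h1, hsucc])
    (fun t u j => by rw [Pi.sub_apply, htail]; exact sub_self _) ξ
  simpa using h.add_const (R.limitState C a α ξ)

lemma stationary_eq {C : Matrix (Fin 2) (Fin 2) ℂ} {a : ℝ} (hC : IsCoin C a) (h0 : 0 < a)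
    (h1 : a < 1) (α : CoverArc G → ℂ) : R.stationary C α = R.limitState C a α :=
  funext fun ξ => (R.tendsto_state hC h0 h1 α ξ).limUnder_eq

lemma islandComfort_single {C : Matrix (Fin 2) (Fin 2) ℂ} {a : ℝ} (hC : IsCoin C a) (h0 : 0 < a)
    (h1 : a < 1) (v : CoverArc G) :
    R.islandComfort C (Pi.single v 1) = (1 + a ^ R.walkLength v) / (1 - a ^ R.walkLength v) := by
  have hOut : ∀ u, ‖C 0 1 * (sheetSign u * R.profile a (Pi.single v 1) u)‖ ^ 2 =
      (1 - a ^ 2) * response R.faceStep a v u ^ 2 := fun u => by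
    rw [R.profile_single, norm_mul, norm_mul, norm_mul, norm_sheetSign, norm_sheetSign, one_mul,
      one_mul, mul_pow, ← Complex.normSq_eq_norm_sq, hC.normSq_entry, Complex.norm_real,
      Real.norm_eq_abs, sq_abs]
  have hIn : ∀ u, ‖C 0 1 * (sheetSign u * R.profile a (Pi.single v 1) (R.faceStep.symm u))‖ ^ 2 =
      (1 - a ^ 2) * response R.faceStep a v (R.faceStep.symm u) ^ 2 := fun u => by
    rw [← hOut, norm_mul, norm_mul, norm_mul, norm_mul, norm_sheetSign, norm_sheetSign]
  have hn : a ^ Function.minimalPeriod R.faceStep v ≠ 1 :=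
    (pow_lt_one₀ h0.le h1 (minimalPeriod_pos_of_finite R.faceStep v).ne').ne
  simp only [islandComfort, R.stationary_eq hC h0 h1, limitState, hOut, hIn]
  rw [Finset.sum_add_distrib, Equiv.sum_comp R.faceStep.symm
    fun u => (1 - a ^ 2) * response R.faceStep a v u ^ 2, ← Finset.mul_sum,
    sum_response_sq R.faceStep hn, walkLength]
  ring

lemma bridgeComfort_single {C : Matrix (Fin 2) (Fin 2) ℂ} {a : ℝ} (hC : IsCoin C a) (h0 : 0 < a)
    (h1 : a < 1) (v : CoverArc G) :
    R.bridgeComfort C (Pi.single v 1) = 1 / 2 * ∑ u : CoverArc G,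
      (response R.faceStep a v (R.faceStep.symm (R.coverRev u)) -
        a * response R.faceStep a v (R.faceStep.symm u)) ^ 2 := by
  rw [bridgeComfort]
  congr 1
  refine Finset.sum_congr rfl fun u _ => ?_
  rw [R.stationary_eq hC h0 h1, limitState, R.profile_single, R.profile_single]
  rw [show sheetSign v * (response R.faceStep a v (R.faceStep.symm (R.coverRev u)) : ℂ) -
      a * (sheetSign v * (response R.faceStep a v (R.faceStep.symm u) : ℂ)) =
      sheetSign v * ((response R.faceStep a v (R.faceStep.symm (R.coverRev u)) -
        a * response R.faceStep a v (R.faceStep.symm u) : ℝ) : ℂ) by push_cast; ring]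
  rw [norm_mul, norm_mul, norm_mul, norm_sheetSign, norm_sheetSign, norm_twistSign, one_mul,
    one_mul, one_mul, Complex.norm_real, Real.norm_eq_abs, sq_abs]

end Finite

end RotationSystem

/-! ### Monotonicity in the face length -/

lemma one_add_pow_div_one_sub_pow_le {a : ℝ} (h0 : 0 < a) (h1 : a < 1) {m n : ℕ} (hm : m ≠ 0)
    (hmn : m ≤ n) : (1 + a ^ n) / (1 - a ^ n) ≤ (1 + a ^ m) / (1 - a ^ m) := by
  have h2 : a ^ n ≤ a ^ m := pow_le_pow_of_le_one h0.le h1.le hmn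
  have h3 : a ^ m < 1 := pow_lt_one₀ h0.le h1 hm
  have h4 : 0 < a ^ m := pow_pos h0 m
  exact div_le_div₀ (by linarith) (by linarith) (by linarith) (by linarith)

lemma islandEnergy_le {a : ℝ} (h0 : 0 < a) (h1 : a < 1) {s t : Multiset ℕ} {m : ℕ} (hm : m ≠ 0)
    (hs : ∀ x ∈ s, m ≤ x) (ht : ∀ x ∈ t, x = m) (hst : s.sum = t.sum) :
    islandEnergy a s ≤ islandEnergy a t := by
  have hsum : ∀ r : Multiset ℕ, (r.map fun x : ℕ => (x : ℝ) * ((1 + a ^ m) / (1 - a ^ m))).sum =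
      (r.sum : ℝ) * ((1 + a ^ m) / (1 - a ^ m)) := fun r => by
    rw [Multiset.sum_map_mul_right, Nat.cast_multiset_sum]
  calc islandEnergy a s
      ≤ (s.map fun x : ℕ => (x : ℝ) * ((1 + a ^ m) / (1 - a ^ m))).sum :=
        Multiset.sum_map_le_sum_map _ _ fun x hx => mul_le_mul_of_nonneg_left
          (one_add_pow_div_one_sub_pow_le h0 h1 hm (hs x hx)) x.cast_nonneg
    _ = (t.map fun x : ℕ => (x : ℝ) * ((1 + a ^ m) / (1 - a ^ m))).sum := by
        rw [hsum, hsum, hst]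
    _ = islandEnergy a t := congrArg Multiset.sum <| Multiset.map_congr rfl fun x hx => by
        rw [islandWeight, ht x hx]

/-! ### The limit as a tends to 1 and optimality of triangulations -/

namespace RotationSystem

variable {V : Type*} [Fintype V] [DecidableEq V] {G : SimpleGraph V} [DecidableRel G.Adj]
  (R : RotationSystem G)

/-- The limit of `δ ^ 2` times the comfortability for the inflow `1` from the tail at `v`. -/
noncomputable def scaledComfort (v : CoverArc G) : ℝ :=
  1 / 2 * ∑ u : CoverArc G,
    (visits R.faceStep v (R.faceStep.symm (R.coverRev u)) (R.walkLength v) / R.walkLength v -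
      visits R.faceStep v (R.faceStep.symm u) (R.walkLength v) / R.walkLength v) ^ 2

lemma tendsto_comfort_single {C : ℝ → Matrix (Fin 2) (Fin 2) ℂ}
    (hC : ∀ δ : ℝ, 0 < δ → δ < 1 → IsCoin (C δ) (1 - δ)) (v : CoverArc G) :
    Tendsto (fun δ => δ ^ 2 * R.comfort (C δ) (Pi.single v 1)) (𝓝[>] 0)
      (𝓝 (R.scaledComfort v)) := by
  have hid : Tendsto (fun δ : ℝ => δ) (𝓝[>] 0) (𝓝 0) := tendsto_id.mono_left nhdsWithin_le_nhds
  have ha : Tendsto (fun δ : ℝ => 1 - δ) (𝓝[>] 0) (𝓝 1) := by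
    simpa using tendsto_const_nhds.sub hid
  have hn : Function.minimalPeriod R.faceStep v ≠ 0 :=
    (minimalPeriod_pos_of_finite R.faceStep v).ne'
  -- The scaled responses stay bounded while 1 - a² tends to 0, so only the bridges contribute to
  -- the limit.
  have hisland : Tendsto (fun δ : ℝ => (1 - (1 - δ) ^ 2) *
      ∑ u, (δ * response R.faceStep (1 - δ) v u) ^ 2) (𝓝[>] 0) (𝓝 0) := by
    have h := ((tendsto_const_nhds (x := (1 : ℝ))).sub (ha.pow 2)).mul
      (tendsto_finsetSum Finset.univ fun u _ => (tendsto_mul_response R.faceStep v u).pow 2)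
    simpa using h
  have hbridge : Tendsto (fun δ : ℝ => 1 / 2 * ∑ u : CoverArc G,
      (δ * response R.faceStep (1 - δ) v (R.faceStep.symm (R.coverRev u)) -
        (1 - δ) * (δ * response R.faceStep (1 - δ) v (R.faceStep.symm u))) ^ 2) (𝓝[>] 0)
      (𝓝 (R.scaledComfort v)) := by
    have h := (tendsto_finsetSum (Finset.univ : Finset (CoverArc G)) fun u _ =>
      ((tendsto_mul_response R.faceStep v (R.faceStep.symm (R.coverRev u))).sub
        (ha.mul (tendsto_mul_response R.faceStep v (R.faceStep.symm u)))).pow 2).const_mul (1 / 2)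
    simp only [one_mul] at h
    exact h
  have h := hisland.add hbridge
  rw [zero_add] at h
  refine h.congr' ?_
  filter_upwards [Ioo_mem_nhdsGT (zero_lt_one (α := ℝ))] with δ hδ
  have hcoin := hC δ hδ.1 hδ.2
  have h0 : 0 < 1 - δ := by linarith [hδ.2]
  have h1 : 1 - δ < 1 := by linarith [hδ.1]
  rw [comfort, R.islandComfort_single hcoin h0 h1, R.bridgeComfort_single hcoin h0 h1, walkLength,
    ← sum_response_sq R.faceStep (pow_lt_one₀ h0.le h1 hn).ne, mul_add]
  simp only [Finset.mul_sum]
  congr 1 <;> exact Finset.sum_congr rfl fun u _ => by ring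

lemma hasLimitComfort :
    R.HasLimitComfort ((∑ v, R.scaledComfort v) / Fintype.card (CoverArc G)) := by
  intro C hC
  have h := (tendsto_finsetSum Finset.univ fun v _ => R.tendsto_comfort_single hC v).div_const
    (Fintype.card (CoverArc G) : ℝ)
  refine h.congr fun δ => ?_
  rw [meanComfort, ← Finset.mul_sum, mul_div_assoc]

lemma sum_visits_walkLength (v : CoverArc G) (σ : Equiv.Perm (CoverArc G)) :
    ∑ u, visits R.faceStep v (σ u) (R.walkLength v) = R.walkLength v := by
  rw [Equiv.sum_comp σ fun u => visits R.faceStep v u (R.walkLength v), sum_visits]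

/-- This is the upper bound obtained by replacing (x - y)² with x + y; each of the two visit counts
sums to the length of the walk. -/
lemma half_sum_visits (v : CoverArc G) :
    1 / 2 * ∑ u : CoverArc G,
      (visits R.faceStep v (R.faceStep.symm (R.coverRev u)) (R.walkLength v) +
        visits R.faceStep v (R.faceStep.symm u) (R.walkLength v)) / (R.walkLength v : ℝ) ^ 2 =
      1 / R.walkLength v := by
  have hn : (R.walkLength v : ℝ) ≠ 0 :=
    Nat.cast_ne_zero.2 (minimalPeriod_pos_of_finite R.faceStep v).ne'
  rw [← Finset.sum_div, Finset.sum_add_distrib, R.sum_visits_walkLength v R.faceStep.symm,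
    show ∑ u, visits R.faceStep v (R.faceStep.symm (R.coverRev u)) (R.walkLength v) =
      R.walkLength v from R.sum_visits_walkLength v (R.coverRev.trans R.faceStep.symm)]
  field_simp
  norm_num

lemma scaledComfort_le (v : CoverArc G) : R.scaledComfort v ≤ 1 / R.walkLength v := by
  classical
  rw [← R.half_sum_visits, scaledComfort]
  refine mul_le_mul_of_nonneg_left (Finset.sum_le_sum fun u _ => ?_) (by norm_num)
  rw [← sub_div, div_pow]
  refine div_le_div_of_nonneg_right ?_ (sq_nonneg _)
  rw [walkLength, visits_eq, visits_eq]
  -- Visits within one period are 0 or 1, so (x - y)² ≤ x + y in all four cases.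
  split_ifs <;> norm_num

variable {R} in
lemma IsTriangulation.scaledComfort_eq (hR : R.IsTriangulation) (v : CoverArc G) :
    R.scaledComfort v = 1 / 3 := by
  classical
  have h : R.scaledComfort v = 1 / R.walkLength v := by
    rw [← R.half_sum_visits, scaledComfort]
    congr 1
    refine Finset.sum_congr rfl fun u _ => ?_
    rw [← sub_div, div_pow]
    congr 1
    rw [walkLength, visits_eq, visits_eq]
    split_ifs with h1 h2
    -- Equality fails only if the walk visits both points; it would then contain both `u` and its
    -- reversal.
    · refine absurd rfl (hR.sameCycle_ne (v := u) (w := R.coverRev u) ?_)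
      have h3 := Equiv.Perm.sameCycle_apply_right.2 h1
      have h4 := Equiv.Perm.sameCycle_apply_right.2 h2
      rw [Equiv.apply_symm_apply] at h3 h4
      exact h4.symm.trans h3
    all_goals norm_num
  rw [h, hR.walkLength_eq]
  norm_num

lemma IsTriangulation.isBest {T : RotationSystem G} (hT : T.IsTriangulation) : T.IsBest := by
  refine ⟨_, T.hasLimitComfort, fun R => ⟨_, R.hasLimitComfort, ?_⟩⟩
  -- The denominator may be 0, when G has no arcs; both means are then 0.
  refine div_le_div_of_nonneg_right (Finset.sum_le_sum fun v _ => ?_) (Nat.cast_nonneg _)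
  rw [hT.scaledComfort_eq]
  refine (R.scaledComfort_le v).trans (one_div_le_one_div_of_le (by norm_num) ?_)
  exact_mod_cast hT.three_le_walkLength R v

lemma IsTriangulation.meanIslandComfort_le {T : RotationSystem G} (hT : T.IsTriangulation)
    {C : Matrix (Fin 2) (Fin 2) ℂ} {a : ℝ} (h0 : 0 < a) (h1 : a < 1) (hC : IsCoin C a) :
    R.meanIslandComfort C ≤ T.meanIslandComfort C := by
  refine div_le_div_of_nonneg_right (Finset.sum_le_sum fun v _ => ?_) (Nat.cast_nonneg _)
  rw [R.islandComfort_single hC h0 h1, T.islandComfort_single hC h0 h1, hT.walkLength_eq]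
  exact one_add_pow_div_one_sub_pow_le h0 h1 (by norm_num) (hT.three_le_walkLength R v)

end RotationSystem

end EmbeddedWalk

theorem corollary2p3 {V : Type*} [Fintype V] [DecidableEq V] (G : SimpleGraph V)
    [DecidableRel G.Adj] (hG : G.Connected)
    (T : EmbeddedWalk.RotationSystem G) (hT : T.IsTriangulation) :
    -- for `0 < a < 1` the walk converges to its stationary state, for every embedding and inflow
    (∀ (R : EmbeddedWalk.RotationSystem G) (C : Matrix (Fin 2) (Fin 2) ℂ) (a : ℝ),
      0 < a → a < 1 → EmbeddedWalk.IsCoin C a →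
        ∀ α : EmbeddedWalk.CoverArc G → ℂ, R.Converges C α) ∧
    -- the triangulation is the best embedding as `a → 1`
    T.IsBest ∧
    -- it is the most comfortable embedding on the islands
    (∀ (C : Matrix (Fin 2) (Fin 2) ℂ) (a : ℝ), 0 < a → a < 1 → EmbeddedWalk.IsCoin C a →
      ∀ R : EmbeddedWalk.RotationSystem G, R.meanIslandComfort C ≤ T.meanIslandComfort C) ∧
    -- its face lengths maximize the island energy among the partitions with parts at least `3`
    (∃ μ : Nat.Partition (Fintype.card G.Dart), μ.parts = T.faceLengths ∧
      ∀ a : ℝ, 0 < a → a < 1 →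
        ∀ ν : Nat.Partition (Fintype.card G.Dart), (∀ x ∈ ν.parts, 3 ≤ x) →
          EmbeddedWalk.islandEnergy a ν.parts ≤ EmbeddedWalk.islandEnergy a μ.parts) ∧
    -- it has no self-intersections
    (∀ v : EmbeddedWalk.CoverArc G, T.selfIntersections v = ∅) := by
  refine ⟨fun R C a h0 h1 hC α ξ => ⟨_, R.tendsto_state hC h0 h1 α ξ⟩, hT.isBest,
    fun C a h0 h1 hC R => hT.meanIslandComfort_le R h0 h1 hC, ?_, hT.selfIntersections_eq_empty⟩
  refine ⟨⟨T.faceLengths, fun {n} hn => ?_, T.sum_faceLengths⟩, rfl, fun a h0 h1 ν hν => ?_⟩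
  · rw [hT.eq_three_of_mem_faceLengths hn]
    norm_num
  · exact EmbeddedWalk.islandEnergy_le h0 h1 three_ne_zero hν
      (fun _ hx => hT.eq_three_of_mem_faceLengths hx)
      (ν.parts_sum.trans T.sum_faceLengths.symm)
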